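/- An instance of size $n$ is a set $U$ with $|U|=n$ and a weight function $w:U\to[0,\infty)$ with $W=\sum_{a\in U}w(a)>0$. An algorithm in the proportional setting is randomized (with arbitrary private randomness) and adaptive, and interacts with the instance only by (1) drawing a proportional sample, independent of the previous ones: an item is drawn that equals $a\in U$ with probability $w(a)/W$, and the algorithm is told its weight $w(a)$; (2) testing whether two of the items drawn so far are the same item. At some point it may stop and return a real number $\hat W$; this is a $(1\pm\varepsilon)$-approximation of $W$ if $(1-\varepsilon)W\le\hat W\le(1+\varepsilon)W$. Only samples are counted. **Theorem.** Let $\varepsilon_0<1$ be a constant and let $m(n,\varepsilon)=o(\sqrt n/\varepsilon)$ as $n\to\infty$, uniformly over $0<\varepsilon\le\varepsilon_0$. Then there is $n_0$ such that for all $n\ge n_0$ and all $0<\varepsilon\le\varepsilon_0$ there is no algorithm in the proportional setting (even one that is designed for these values of $n$ and $\varepsilon$, so that it knows $n$) which on every instance of size $n$ almost surely takes at most $m(n,\varepsilon)$ samples and returns a $(1\pm\varepsilon)$-approximation of $W$ with probability at least $2/3$. The same holds if the algorithm is only required to take at most $m(n,\varepsilon)$ samples in expectation on every instance of size $n$. 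-/

import Mathlib

open MeasureTheory Filter Asymptotics
open scoped ENNReal Topology

/-! Sum estimation by proportional sampling: instances, the interaction model, sample counts. -/

/-- An instance of size `n`: a set of `n` items with nonnegative weights, not all zero
(so that proportional sampling makes sense). -/
structure SumInstance (n : ℕ) where
  w : Fin n → ℝ
  nonneg : ∀ a, 0 ≤ w a
  total_pos : 0 < ∑ a, w a

namespace SumInstance

variable {n : ℕ} (I : SumInstance n)

/-- The total weight `W`. -/
def total : ℝ := ∑ a, I.w a

/-- The law of one proportional sample: item `a` has probability `w a / W`. -/
noncomputable def samplePMF : PMF (Fin n) :=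
  PMF.ofFintype (fun a => ENNReal.ofReal (I.w a / I.total)) (by
    have h : 0 < I.total := I.total_pos
    rw [← ENNReal.ofReal_sum_of_nonneg (fun a _ => div_nonneg (I.nonneg a) h.le),
      ← Finset.sum_div]
    change ENNReal.ofReal (I.total / I.total) = 1
    rw [div_self h.ne', ENNReal.ofReal_one])

/-- The law of an infinite sequence of independent proportional samples. -/
noncomputable def sampleSeq : Measure (ℕ → Fin n) :=
  Measure.infinitePi (fun _ : ℕ => I.samplePMF.toMeasure)

end SumInstance

/-- What an algorithm can do next: draw a proportional sample, test whether the items drawn as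
sample number `i` and as sample number `j` (counted from `0`) are the same item, or stop with an
estimate. -/
inductive PropAction where
  | sample : PropAction
  | compare (i j : ℕ) : PropAction
  | output (v : ℝ) : PropAction

namespace PropAction

def toSum : PropAction → Unit ⊕ (ℕ × ℕ) ⊕ ℝ
  | sample => Sum.inl ()
  | compare i j => Sum.inr (Sum.inl (i, j))
  | output v => Sum.inr (Sum.inr v)

instance : MeasurableSpace PropAction := MeasurableSpace.comap toSum inferInstance

end PropAction

/-- What an algorithm is told: the weight of the item just drawn, or the outcome of a comparison.
The item itself is never revealed. -/
inductive PropAnswer where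
  | weight (r : ℝ) : PropAnswer
  | same (b : Bool) : PropAnswer

/-- A randomized adaptive algorithm in the proportional setting whose private randomness is a
seed in `Ω`: from the seed and the list of all answers received so far it chooses the next
action. -/
structure PropAlgorithm (Ω : Type*) [MeasurableSpace Ω] where
  act : Ω → List PropAnswer → PropAction
  measurable_act : ∀ h, Measurable fun ω => act ω h

/-- The state of a run: number of samples drawn, answers received, and the output, if any. -/
structure PropState where
  count : ℕ
  hist : List PropAnswer
  out : Option ℝ

namespace PropAlgorithm

variable {Ω : Type*} [MeasurableSpace Ω] {n : ℕ}

/-- One step of the run with seed `ω` when the successive samples are `x 0, x 1, …`. A comparison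
that mentions an item not drawn yet is answered `false`. -/
noncomputable def step (A : PropAlgorithm Ω) (I : SumInstance n) (ω : Ω) (x : ℕ → Fin n)
    (s : PropState) : PropState :=
  match s.out with
  | some _ => s
  | none =>
    match A.act ω s.hist with
    | .sample => ⟨s.count + 1, s.hist ++ [.weight (I.w (x s.count))], none⟩
    | .compare i j =>
        ⟨s.count, s.hist ++ [.same (decide (i < s.count ∧ j < s.count ∧ x i = x j))], none⟩
    | .output v => ⟨s.count, s.hist, some v⟩

/-- The state after `t` steps. -/
noncomputable def run (A : PropAlgorithm Ω) (I : SumInstance n) (ω : Ω) (x : ℕ → Fin n)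
    (t : ℕ) : PropState :=
  (A.step I ω x)^[t] ⟨0, [], none⟩

/-- The total number of samples drawn (`∞` if the algorithm samples forever). -/
noncomputable def sampleCount (A : PropAlgorithm Ω) (I : SumInstance n) (ω : Ω)
    (x : ℕ → Fin n) : ℝ≥0∞ :=
  ⨆ t, ((A.run I ω x t).count : ℝ≥0∞)

/-- The algorithm halts and its output is a `(1 ± ε)`-approximation of the total weight. -/
def Succeeds (A : PropAlgorithm Ω) (I : SumInstance n) (ε : ℝ) (ω : Ω) (x : ℕ → Fin n) : Prop :=
  ∃ t v, (A.run I ω x t).out = some v ∧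
    (1 - ε) * I.total ≤ v ∧ v ≤ (1 + ε) * I.total

/-- On every instance of size `n` the algorithm returns a `(1 ± ε)`-approximation of the total
weight with probability at least `2/3`, over the seed and the samples. -/
def Approximates (A : PropAlgorithm Ω) (μ : Measure Ω) (n : ℕ) (ε : ℝ) : Prop :=
  ∀ I : SumInstance n, 2 / 3 ≤ (μ.prod I.sampleSeq) {p | A.Succeeds I ε p.1 p.2}

/-- On every instance of size `n` the algorithm draws at most `m` samples, almost surely. -/
def WorstCaseSamplesLE (A : PropAlgorithm Ω) (μ : Measure Ω) (n : ℕ) (m : ℝ) : Prop :=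
  ∀ I : SumInstance n,
    ∀ᵐ p ∂(μ.prod I.sampleSeq), A.sampleCount I p.1 p.2 ≤ ENNReal.ofReal m

/-- On every instance of size `n` the expected number of samples drawn is at most `m`. -/
def ExpectedSamplesLE (A : PropAlgorithm Ω) (μ : Measure Ω) (n : ℕ) (m : ℝ) : Prop :=
  ∀ I : SumInstance n,
    ∫⁻ p, A.sampleCount I p.1 p.2 ∂(μ.prod I.sampleSeq) ≤ ENNReal.ofReal m

end PropAlgorithm

/-! This is Le Cam's method with a mixture. The base instance has one heavy item of weight `H`, `N`
blocks of `b` items of weight 1, and zeros. An alternative keeps in each block `i` only the pattern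
`f i`, with `f` random. On a sample sequence that an alternative can produce, base and alternative
show equal weights and equal comparisons, so the runs coincide (`run_congr`). Only the laws of the
item sequences differ.

By Markov the algorithm may be cut off after `s = ⌊20 m⌋` samples at a loss of 1/20. The success
windows of the two totals are disjoint, so it suffices that the mixture is within 1/5 of the base
law on tests: `2 (2/3 - 1/20) - 1/5 > 1` (`false_of_secondMoment`). That closeness follows once the
averaged product of two likelihood ratios is at most `1 + 1/25`.

This product depends only on the number of blocks where `f` and `f'` agree, which is binomial with
mean `N / b`. With `θ = s W' / W ^ 2`, the exponent is at most `s κ + (N / b) θ ^ 2`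
(`secondMoment_le`). Here `κ` measures what a single sample reveals through the frequency of the
heavy item. The quadratic term measures what is revealed by several samples in one block.

Separation needs the kept and full totals to differ by a relative amount of order `ε`. Blocks that
lose one item serve for `ε < 1/4`, blocks that keep one item for larger `ε`. In all regimes the
exponent is small when `s ε` is a small multiple of `√n`. -/

namespace PropAlgorithm

variable {Ω : Type*} [MeasurableSpace Ω] {n : ℕ}

/-! ### Runs with a bounded number of samples -/

theorem run_succ (A : PropAlgorithm Ω) (I : SumInstance n) (ω : Ω) (x : ℕ → Fin n) (t : ℕ) :
    A.run I ω x (t + 1) = A.step I ω x (A.run I ω x t) :=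
  Function.iterate_succ_apply' _ _ _

theorem count_le_step (A : PropAlgorithm Ω) (I : SumInstance n) (ω : Ω) (x : ℕ → Fin n)
    (σ : PropState) : σ.count ≤ (A.step I ω x σ).count := by
  unfold step
  split
  · exact le_rfl
  · split <;> simp

theorem step_of_out (A : PropAlgorithm Ω) (I : SumInstance n) (ω : Ω) (x : ℕ → Fin n)
    {σ : PropState} {v : ℝ} (h : σ.out = some v) : A.step I ω x σ = σ := by
  unfold step
  rw [h]

theorem run_out_mono (A : PropAlgorithm Ω) (I : SumInstance n) (ω : Ω) (x : ℕ → Fin n)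
    {t t' : ℕ} (htt : t ≤ t') {v : ℝ} (h : (A.run I ω x t).out = some v) :
    A.run I ω x t' = A.run I ω x t := by
  induction t', htt using Nat.le_induction with
  | base => rfl
  | succ k _ ih => rw [run_succ, ih, step_of_out A I ω x h]

theorem run_out_unique (A : PropAlgorithm Ω) (I : SumInstance n) (ω : Ω) (x : ℕ → Fin n)
    {t t' : ℕ} {v v' : ℝ} (h : (A.run I ω x t).out = some v)
    (h' : (A.run I ω x t').out = some v') : v = v' := by
  rcases le_total t t' with hle | hle
  · rw [run_out_mono A I ω x hle h, h] at h'
    exact Option.some.inj h'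
  · rw [run_out_mono A I ω x hle h', h'] at h
    exact (Option.some.inj h).symm

/-- A run that has drawn at most `s` samples depends only on the first `s` items and their
weights. -/
theorem run_congr (A : PropAlgorithm Ω) {I I' : SumInstance n} (ω : Ω) {x x' : ℕ → Fin n} {s : ℕ}
    (hx : ∀ i < s, x i = x' i) (hw : ∀ i < s, I.w (x i) = I'.w (x i)) (t : ℕ)
    (ht : (A.run I ω x t).count ≤ s) : A.run I' ω x' t = A.run I ω x t := by
  induction t with
  | zero => rfl
  | succ t ih =>
    rw [run_succ] at ht
    have hc := (count_le_step A I ω x (A.run I ω x t)).trans ht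
    rw [run_succ, run_succ, ih hc]
    generalize A.run I ω x t = σ at ht hc
    unfold step at ht ⊢
    split
    · rfl
    · rename_i h
      rw [h] at ht
      split
      · rename_i ha
        simp only [ha] at ht
        rw [hw _ ht, hx _ ht]
      -- A positive answer requires both indices below `σ.count ≤ s`, so only shared samples matter.
      · congr 4
        rw [decide_eq_decide]
        constructor
        · rintro ⟨h1, h2, h3⟩
          exact ⟨h1, h2, by rw [hx _ (h1.trans_le hc), hx _ (h2.trans_le hc), h3]⟩
        · rintro ⟨h1, h2, h3⟩
          exact ⟨h1, h2, by rw [← hx _ (h1.trans_le hc), ← hx _ (h2.trans_le hc), h3]⟩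
      · rfl

/-- The run halts within `s` samples with an output in `R`. -/
def HaltsIn (A : PropAlgorithm Ω) (I : SumInstance n) (s : ℕ) (R : Set ℝ) (ω : Ω)
    (x : ℕ → Fin n) : Prop :=
  ∃ t v, (A.run I ω x t).out = some v ∧ v ∈ R ∧ (A.run I ω x t).count ≤ s

/-- The run draws more than `s` samples. -/
def Exceeds (A : PropAlgorithm Ω) (I : SumInstance n) (s : ℕ) (ω : Ω) (x : ℕ → Fin n) : Prop :=
  ∃ t, s < (A.run I ω x t).count

theorem HaltsIn.congr {A : PropAlgorithm Ω} {I I' : SumInstance n} {s : ℕ} {R : Set ℝ} {ω : Ω}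
    {x x' : ℕ → Fin n} (hx : ∀ i < s, x i = x' i) (hw : ∀ i < s, I.w (x i) = I'.w (x i))
    (h : A.HaltsIn I s R ω x) : A.HaltsIn I' s R ω x' := by
  obtain ⟨t, v, h1, h2, h3⟩ := h
  refine ⟨t, v, ?_⟩
  rw [run_congr A ω hx hw t h3]
  exact ⟨h1, h2, h3⟩

/-- If the run on `x'` had drawn at most `s` samples by that time, `run_congr` would carry this back
to `x`. -/
theorem Exceeds.congr {A : PropAlgorithm Ω} {I : SumInstance n} {s : ℕ} {ω : Ω}
    {x x' : ℕ → Fin n} (hx : ∀ i < s, x i = x' i) (h : A.Exceeds I s ω x) :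
    A.Exceeds I s ω x' := by
  obtain ⟨t, ht⟩ := h
  refine ⟨t, not_le.mp fun hle => ?_⟩
  rw [run_congr A ω (fun i hi => (hx i hi).symm) (fun _ _ => rfl) t hle] at ht
  exact absurd ht (not_lt.mpr hle)

theorem HaltsIn.not_of_disjoint {A : PropAlgorithm Ω} {I : SumInstance n} {s : ℕ}
    {R R' : Set ℝ} (hR : Disjoint R R') {ω : Ω} {x : ℕ → Fin n} (h : A.HaltsIn I s R ω x) :
    ¬ A.HaltsIn I s R' ω x := by
  rintro ⟨t', v', h1', h2', -⟩
  obtain ⟨t, v, h1, h2, -⟩ := h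
  rw [run_out_unique A I ω x h1 h1'] at h2
  exact Set.disjoint_left.mp hR h2 h2'

theorem Succeeds.haltsIn_or_exceeds {A : PropAlgorithm Ω} {I : SumInstance n} {ε : ℝ} {ω : Ω}
    {x : ℕ → Fin n} (h : A.Succeeds I ε ω x) (s : ℕ) :
    A.HaltsIn I s (Set.Icc ((1 - ε) * I.total) ((1 + ε) * I.total)) ω x ∨ A.Exceeds I s ω x := by
  obtain ⟨t, v, h1, h2⟩ := h
  rcases le_or_gt (A.run I ω x t).count s with hc | hc
  · exact Or.inl ⟨t, v, h1, h2, hc⟩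
  · exact Or.inr ⟨t, hc⟩

/-! ### Measurability in the seed -/

/-- Sets of states whose trace on the halted states is measurable in the output. -/
def MeasurableStates (P : Set PropState) : Prop :=
  ∀ c h, MeasurableSet {v : ℝ | (⟨c, h, some v⟩ : PropState) ∈ P}

theorem measurableSet_step (A : PropAlgorithm Ω) (I : SumInstance n) (x : ℕ → Fin n)
    {P : Set PropState} (hP : MeasurableStates P) (c : ℕ) (h : List PropAnswer) :
    MeasurableSet {ω | A.step I ω x ⟨c, h, none⟩ ∈ P} := by
  let r : Unit ⊕ (ℕ × ℕ) ⊕ ℝ → PropState := fun a => match a with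
    | .inl _ => ⟨c + 1, h ++ [.weight (I.w (x c))], none⟩
    | .inr (.inl (i, j)) => ⟨c, h ++ [.same (decide (i < c ∧ j < c ∧ x i = x j))], none⟩
    | .inr (.inr v) => ⟨c, h, some v⟩
  have hr : MeasurableSet (r ⁻¹' P) :=
    measurableSet_sum_iff.mpr ⟨MeasurableSet.of_discrete,
      measurableSet_sum_iff.mpr ⟨MeasurableSet.of_discrete, hP c h⟩⟩
  have h2 : MeasurableSet (PropAction.toSum ⁻¹' (r ⁻¹' P)) := ⟨_, hr, rfl⟩
  convert A.measurable_act h h2 using 1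
  ext ω
  simp only [Set.mem_ofPred_eq, Set.mem_preimage, step]
  cases A.act ω h <;> rfl

/-- `measurable_act` treats one history at a time, so countability of the reachable histories is
carried through the induction. It holds because, for fixed `x`, a step appends a determined weight
or one of two Booleans. Arbitrary reals enter only as outputs, which end the run. -/
theorem measurableSet_run (A : PropAlgorithm Ω) (I : SumInstance n) (x : ℕ → Fin n) (t : ℕ) :
    (∃ C : Set (ℕ × List PropAnswer), C.Countable ∧
      ∀ ω, ((A.run I ω x t).count, (A.run I ω x t).hist) ∈ C) ∧
    ∀ P, MeasurableStates P → MeasurableSet {ω | A.run I ω x t ∈ P} := by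
  induction t with
  | zero =>
    refine ⟨⟨{(0, [])}, Set.countable_singleton _, fun ω => rfl⟩, fun P _ => ?_⟩
    exact MeasurableSet.const ((⟨0, [], none⟩ : PropState) ∈ P)
  | succ t ih =>
    obtain ⟨⟨C, hC, hmem⟩, hmeas⟩ := ih
    constructor
    · refine ⟨C ∪ (fun q => (q.1 + 1, q.2 ++ [.weight (I.w (x q.1))])) '' C ∪
        (fun q => (q.1, q.2 ++ [.same true])) '' C ∪
        (fun q => (q.1, q.2 ++ [.same false])) '' C,
        ((hC.union (hC.image _)).union (hC.image _)).union (hC.image _), fun ω => ?_⟩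
      have hm := hmem ω
      rw [run_succ]
      generalize A.run I ω x t = σ at hm
      unfold step
      split
      · exact Or.inl (Or.inl (Or.inl hm))
      · split
        · exact Or.inl (Or.inl (Or.inr ⟨_, hm, rfl⟩))
        · rename_i i j _
          cases hd : decide (i < σ.count ∧ j < σ.count ∧ x i = x j)
          · exact Or.inr ⟨_, hm, rfl⟩
          · exact Or.inl (Or.inr ⟨_, hm, rfl⟩)
        · exact Or.inl (Or.inl (Or.inl hm))
    · intro P hP
      have hset : {ω | A.run I ω x (t + 1) ∈ P} =
          {ω | A.run I ω x t ∈ {σ | σ ∈ P ∧ σ.out ≠ none}} ∪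
          ⋃ q ∈ C, ({ω | A.run I ω x t ∈ ({⟨q.1, q.2, none⟩} : Set PropState)} ∩
            {ω | A.step I ω x ⟨q.1, q.2, none⟩ ∈ P}) := by
        ext ω
        have hm := hmem ω
        simp only [Set.mem_ofPred_eq, Set.mem_union, Set.mem_iUnion, Set.mem_inter_iff,
          Set.mem_singleton_iff, exists_prop, Prod.exists, run_succ]
        generalize A.run I ω x t = σ at hm
        obtain ⟨c, h, o⟩ := σ
        cases o with
        | some v => simp [step_of_out A I ω x (σ := ⟨c, h, some v⟩) rfl]
        | none =>
          constructor
          · exact fun hs => Or.inr ⟨c, h, hm, rfl, hs⟩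
          · rintro (⟨_, h2⟩ | ⟨c', h', -, heq, hs⟩)
            · exact absurd rfl h2
            · rw [heq]; exact hs
      rw [hset]
      refine (hmeas _ fun c h => ?_).union
        (MeasurableSet.biUnion hC fun q _ => (hmeas _ fun c h => ?_).inter
          (measurableSet_step A I x hP _ _))
      · simpa using hP c h
      · simp

theorem measurableSet_haltsIn (A : PropAlgorithm Ω) (I : SumInstance n) (s : ℕ) {R : Set ℝ}
    (hR : MeasurableSet R) (x : ℕ → Fin n) : MeasurableSet {ω | A.HaltsIn I s R ω x} := by
  have : {ω | A.HaltsIn I s R ω x} = ⋃ t, {ω | A.run I ω x t ∈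
      {σ : PropState | ∃ v, σ.out = some v ∧ v ∈ R ∧ σ.count ≤ s}} := by
    ext ω
    simp [HaltsIn]
  rw [this]
  refine MeasurableSet.iUnion fun t => (measurableSet_run A I x t).2 _ fun c h => ?_
  convert hR.inter (MeasurableSet.const (c ≤ s)) using 1
  ext v
  simp

theorem measurableSet_exceeds (A : PropAlgorithm Ω) (I : SumInstance n) (s : ℕ)
    (x : ℕ → Fin n) : MeasurableSet {ω | A.Exceeds I s ω x} := by
  have : {ω | A.Exceeds I s ω x} = ⋃ t, {ω | A.run I ω x t ∈
      {σ : PropState | s < σ.count}} := by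
    ext ω
    simp [Exceeds]
  rw [this]
  exact MeasurableSet.iUnion fun t => (measurableSet_run A I x t).2 _ fun c h =>
    MeasurableSet.const (s < c)

end PropAlgorithm

/-! ### Events that depend on finitely many samples -/

/-- Extend a finite sequence by a constant. -/
def extendSeq {n s : ℕ} (a : Fin n) (z : Fin s → Fin n) (i : ℕ) : Fin n :=
  if h : i < s then z ⟨i, h⟩ else a

theorem extendSeq_coe {n s : ℕ} (a : Fin n) (z : Fin s → Fin n) (i : Fin s) :
    extendSeq a z i = z i := by
  simp [extendSeq]

namespace SumInstance

variable {n : ℕ}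

instance (I : SumInstance n) : IsProbabilityMeasure I.sampleSeq := by
  unfold sampleSeq
  infer_instance

theorem sampleSeq_cylinder (I : SumInstance n) {s : ℕ} (z : Fin s → Fin n) :
    I.sampleSeq {x | ∀ i : Fin s, x i = z i} =
      ∏ i, ENNReal.ofReal (I.w (z i) / I.total) := by
  -- For `s > 0` the entry `z 0` supplies the filler item of `extendSeq`.
  rcases s.eq_zero_or_pos with rfl | hs
  · simp
  have h : {x : ℕ → Fin n | ∀ i : Fin s, x i = z i} =
      Set.pi (Finset.range s : Set ℕ) (fun i => {extendSeq (z ⟨0, hs⟩) z i}) := by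
    ext x
    simp only [Set.mem_ofPred_eq, Set.mem_pi, Finset.coe_range, Set.mem_Iio,
      Set.mem_singleton_iff]
    constructor
    · intro h i hi
      rw [h ⟨i, hi⟩, ← extendSeq_coe (z ⟨0, hs⟩) z ⟨i, hi⟩]
    · intro h i
      rw [h i i.2, extendSeq_coe]
  rw [h, sampleSeq, Measure.infinitePi_pi _ (fun i _ => MeasurableSet.singleton _),
    Finset.prod_range]
  refine Finset.prod_congr rfl fun i _ => ?_
  rw [PMF.toMeasure_apply_singleton _ _ (MeasurableSet.singleton _), extendSeq_coe]
  rfl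

/-- Splitting by the first `s` samples gives finitely many disjoint rectangles, so measurability and
probability reduce to the seed alone. -/
theorem setOf_local_eq {Ω : Type*} {s : ℕ} (a : Fin n) {P : Ω → (ℕ → Fin n) → Prop}
    (hP : ∀ ω x x', (∀ i < s, x i = x' i) → P ω x → P ω x') :
    {p : Ω × (ℕ → Fin n) | P p.1 p.2} = ⋃ z : Fin s → Fin n,
      {ω | P ω (extendSeq a z)} ×ˢ {x | ∀ i : Fin s, x i = z i} := by
  ext ⟨ω, x⟩
  simp only [Set.mem_ofPred_eq, Set.mem_iUnion, Set.mem_prod]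
  constructor
  · refine fun h => ⟨fun i => x i, hP _ _ _ (fun i hi => ?_) h, fun _ => rfl⟩
    simp [extendSeq, hi]
  · rintro ⟨z, h, hz⟩
    refine hP _ _ _ (fun i hi => ?_) h
    rw [hz ⟨i, hi⟩, ← extendSeq_coe a z ⟨i, hi⟩]

variable {Ω : Type*} [MeasurableSpace Ω]

theorem measurableSet_cylinder {s : ℕ} (z : Fin s → Fin n) :
    MeasurableSet {x : ℕ → Fin n | ∀ i : Fin s, x i = z i} := by
  rw [Set.ofPred_forall]
  exact MeasurableSet.iInter fun i => measurableSet_eq_fun (measurable_pi_apply _) measurable_const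

theorem measurableSet_local {s : ℕ} (a : Fin n) {P : Ω → (ℕ → Fin n) → Prop}
    (hP : ∀ ω x x', (∀ i < s, x i = x' i) → P ω x → P ω x')
    (hm : ∀ x, MeasurableSet {ω | P ω x}) :
    MeasurableSet {p : Ω × (ℕ → Fin n) | P p.1 p.2} := by
  rw [setOf_local_eq a hP]
  exact MeasurableSet.iUnion fun z => (hm _).prod (measurableSet_cylinder z)

/-- The probability of an event that depends only on the seed and the first `s` samples. -/
theorem prod_real_local (I : SumInstance n) (μ : Measure Ω) [IsProbabilityMeasure μ] {s : ℕ}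
    (a : Fin n) {P : Ω → (ℕ → Fin n) → Prop}
    (hP : ∀ ω x x', (∀ i < s, x i = x' i) → P ω x → P ω x')
    (hm : ∀ x, MeasurableSet {ω | P ω x}) :
    (μ.prod I.sampleSeq).real {p | P p.1 p.2} =
      ∑ z : Fin s → Fin n, (∏ i, I.w (z i) / I.total) * μ.real {ω | P ω (extendSeq a z)} := by
  rw [setOf_local_eq a hP, measureReal_iUnion_fintype]
  · refine Finset.sum_congr rfl fun z _ => ?_
    rw [measureReal_prod_prod, mul_comm]
    congr 1
    rw [Measure.real, sampleSeq_cylinder, ENNReal.toReal_prod]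
    exact Finset.prod_congr rfl fun i _ =>
      ENNReal.toReal_ofReal (div_nonneg (I.nonneg _) I.total_pos.le)
  · intro z z' hz
    refine Set.disjoint_left.mpr ?_
    rintro ⟨ω, x⟩ ⟨-, h1⟩ ⟨-, h2⟩
    exact hz (funext fun i => (h1 i).symm.trans (h2 i))
  · exact fun z => (hm _).prod (measurableSet_cylinder z)

end SumInstance

/-! ### Truncation by Markov's inequality -/

namespace PropAlgorithm

variable {Ω : Type*} [MeasurableSpace Ω] {n : ℕ}

/-- Markov's inequality at level `s + 1`, since the count is an integer. -/
theorem exceeds_real_le (A : PropAlgorithm Ω) (μ : Measure Ω) [IsProbabilityMeasure μ]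
    (I : SumInstance n) (a : Fin n) {s : ℕ} {m : ℝ} (hs : 20 * m < s + 1)
    (hA : A.ExpectedSamplesLE μ n m) :
    (μ.prod I.sampleSeq).real {p | A.Exceeds I s p.1 p.2} ≤ 1 / 20 := by
  have hmeas : MeasurableSet {p : Ω × (ℕ → Fin n) | A.Exceeds I s p.1 p.2} :=
    SumInstance.measurableSet_local a (fun ω x x' hx h => h.congr hx)
      (measurableSet_exceeds A I s)
  have h1 : ((s : ℝ≥0∞) + 1) * (μ.prod I.sampleSeq) {p | A.Exceeds I s p.1 p.2} ≤
      ENNReal.ofReal m := by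
    refine le_trans ?_ (hA I)
    rw [← lintegral_indicator_const hmeas]
    refine lintegral_mono (Set.indicator_le fun p hp => ?_)
    obtain ⟨t, ht⟩ := hp
    refine le_trans ?_ (le_iSup _ t)
    exact_mod_cast ht
  have h2 := ENNReal.toReal_mono ENNReal.ofReal_ne_top h1
  rw [ENNReal.toReal_mul, ← Measure.real] at h2
  have h3 : ((s : ℝ≥0∞) + 1).toReal = (s : ℝ) + 1 := by
    exact_mod_cast ENNReal.toReal_natCast (s + 1)
  rw [h3, ENNReal.toReal_ofReal'] at h2
  have hs0 : (0 : ℝ) < s + 1 := by positivity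
  by_contra! hlt
  have h4 := mul_lt_mul_of_pos_left hlt hs0
  rcases max_cases m 0 with ⟨h5, -⟩ | ⟨h5, -⟩ <;> rw [h5] at h2 <;> linarith

/-- The event `Succeeds` enters only through monotonicity of the measure, so its own measurability
is not needed. -/
theorem haltsIn_real_ge (A : PropAlgorithm Ω) (μ : Measure Ω) [IsProbabilityMeasure μ]
    (I : SumInstance n) (a : Fin n) {s : ℕ} {m ε : ℝ} (hs : 20 * m < s + 1)
    (hA : A.ExpectedSamplesLE μ n m) (hA' : A.Approximates μ n ε) :
    2 / 3 - 1 / 20 ≤ (μ.prod I.sampleSeq).real {p | A.HaltsIn I s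
      (Set.Icc ((1 - ε) * I.total) ((1 + ε) * I.total)) p.1 p.2} := by
  have h1 := ENNReal.toReal_mono (measure_ne_top _ _) (hA' I)
  have h2 : (2 / 3 : ℝ≥0∞).toReal = 2 / 3 := by simp
  rw [h2, ← Measure.real] at h1
  have h3 : {p : Ω × (ℕ → Fin n) | A.Succeeds I ε p.1 p.2} ⊆
      {p | A.HaltsIn I s (Set.Icc ((1 - ε) * I.total) ((1 + ε) * I.total)) p.1 p.2} ∪
      {p | A.Exceeds I s p.1 p.2} := fun p hp => hp.haltsIn_or_exceeds s
  have h4 := (measureReal_mono (μ := μ.prod I.sampleSeq) h3).trans (measureReal_union_le _ _)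
  have h5 := exceeds_real_le A μ I a hs hA
  linarith

end PropAlgorithm

/-! ### The second moment method -/

/-- If the likelihood ratios `L f` of a family of laws with respect to `p` have an averaged second
moment close to `1`, then the average of the family is close to `p` on tests. -/
theorem sum_test_le_of_secondMoment {Z ι : Type*} [Fintype Z] [Fintype ι] [Nonempty ι]
    (p v : Z → ℝ) (L : ι → Z → ℝ) (hp : ∀ z, 0 ≤ p z) (hp1 : ∑ z, p z = 1)
    (hv0 : ∀ z, 0 ≤ v z) (hv1 : ∀ z, v z ≤ 1) (hL : ∀ f, ∑ z, p z * L f z = 1)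
    (h2 : ∑ f, ∑ f', ∑ z, p z * (L f z * L f' z) ≤ (Fintype.card ι : ℝ) ^ 2 * (1 + 1 / 25)) :
    ∑ f, ∑ z, p z * L f z * v z ≤ Fintype.card ι * (∑ z, p z * v z + 1 / 5) := by
  set c : ℝ := (Fintype.card ι : ℝ)
  have hc : 0 < c := by simpa [c] using Fintype.card_pos (α := ι)
  set S : Z → ℝ := fun z => ∑ f, L f z
  have e1 : ∑ f, ∑ z, p z * L f z * v z = ∑ z, p z * S z * v z := by
    rw [Finset.sum_comm]
    simp only [S, Finset.mul_sum, Finset.sum_mul]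
  have e2 : ∑ z, p z * S z = c := by
    simp only [S, Finset.mul_sum]
    rw [Finset.sum_comm, Finset.sum_congr rfl fun f _ => hL f]
    simp [c]
  have e3 : ∑ f, ∑ f', ∑ z, p z * (L f z * L f' z) = ∑ z, p z * S z ^ 2 := by
    simp only [S, pow_two, Finset.sum_mul_sum]
    simp only [Finset.mul_sum]
    exact (Finset.sum_comm.trans (Finset.sum_congr rfl fun f _ => Finset.sum_comm)).symm
  rw [e3] at h2
  rw [e1]
  have key : ∀ z, p z * S z * v z ≤ c * (p z * v z) +
      (5 / 2 / c * (p z * S z ^ 2) - 5 * (p z * S z) + 5 / 2 * c * p z + c / 10 * p z) := by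
    intro z
    -- Weighted AM-GM in place of Cauchy–Schwarz; integrated against `p`, it gives `5/2 * 1/25 +
    -- 1/10 = 1/5`.
    have hy : (S z / c - 1) * v z ≤ 5 / 2 * (S z / c - 1) ^ 2 + 1 / 10 := by
      have := sq_nonneg (5 * (S z / c - 1) - v z)
      have hv := mul_le_mul (hv1 z) (hv1 z) (hv0 z) zero_le_one
      nlinarith
    have := mul_le_mul_of_nonneg_left hy (mul_nonneg hc.le (hp z))
    have e4 : c * p z * ((S z / c - 1) * v z) = p z * S z * v z - c * (p z * v z) := by
      field_simp
    have e5 : c * p z * (5 / 2 * (S z / c - 1) ^ 2 + 1 / 10) =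
      5 / 2 / c * (p z * S z ^ 2) - 5 * (p z * S z) + 5 / 2 * c * p z + c / 10 * p z := by
      field_simp
      ring
    linarith
  refine (Finset.sum_le_sum fun z _ => key z).trans ?_
  rw [Finset.sum_add_distrib, Finset.sum_add_distrib, Finset.sum_add_distrib,
    Finset.sum_sub_distrib, ← Finset.mul_sum, ← Finset.mul_sum, ← Finset.mul_sum,
    ← Finset.mul_sum, ← Finset.mul_sum, e2, hp1]
  have h6 : 5 / 2 / c * ∑ z, p z * S z ^ 2 ≤ 5 / 2 / c * (c ^ 2 * (1 + 1 / 25)) :=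
    mul_le_mul_of_nonneg_left h2 (by positivity)
  have e6 : 5 / 2 / c * (c ^ 2 * (1 + 1 / 25)) = 13 / 5 * c := by
    field_simp
    norm_num
  linarith

theorem sum_prod_fin_eq_pow {α : Type*} [Fintype α] (s : ℕ) (g : α → ℝ) :
    ∑ z : Fin s → α, ∏ i, g (z i) = (∑ a, g a) ^ s := by
  classical
  rw [← Fintype.piFinset_univ, Finset.sum_prod_piFinset]
  simp

namespace PropAlgorithm

variable {Ω : Type*} [MeasurableSpace Ω] {n : ℕ}

/-- Le Cam's method for a base instance `I` and a family of instances obtained from it by setting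
some weights to zero. -/
theorem false_of_secondMoment {ι : Type*} [Fintype ι] [Nonempty ι] (I : SumInstance n)
    (J : ι → SumInstance n) {W : ℝ} (hJ : ∀ f a, (J f).w a = 0 ∨ (J f).w a = I.w a)
    (hW : ∀ f, (J f).total = W) {s : ℕ} {m ε : ℝ} (hsep : (1 + ε) * W < (1 - ε) * I.total)
    (h2 : ∑ f, ∑ f', (I.total / W ^ 2 * ∑ a, (J f).w a * (J f').w a / I.w a) ^ s ≤
      (Fintype.card ι : ℝ) ^ 2 * (1 + 1 / 25))
    (hs : 20 * m < s + 1) (A : PropAlgorithm Ω) (μ : Measure Ω) [IsProbabilityMeasure μ]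
    (hA : A.ExpectedSamplesLE μ n m) (hA' : A.Approximates μ n ε) : False := by
  have hI := I.total_pos
  change 0 < I.total at hI
  have hWpos : 0 < W := by
    obtain ⟨f⟩ := ‹Nonempty ι›
    rw [← hW f]
    exact (J f).total_pos
  obtain ⟨a⟩ : Nonempty (Fin n) := by
    by_contra h
    rw [not_nonempty_iff] at h
    have := I.total_pos
    simp at this
  set R' := Set.Icc ((1 - ε) * I.total) ((1 + ε) * I.total)
  set R := Set.Icc ((1 - ε) * W) ((1 + ε) * W)
  have hdisj : Disjoint R' R := Set.disjoint_left.mpr fun v h h' => by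
    have := h.1; have := h'.2; linarith
  let p : (Fin s → Fin n) → ℝ := fun z => ∏ i, I.w (z i) / I.total
  -- The test runs on the base instance `I` but aims at the window of `W`.
  let v : (Fin s → Fin n) → ℝ := fun z => μ.real {ω | A.HaltsIn I s R ω (extendSeq a z)}
  let u : (Fin s → Fin n) → ℝ := fun z => μ.real {ω | A.HaltsIn I s R' ω (extendSeq a z)}
  let r : ι → Fin n → ℝ := fun f b => I.total / W * ((J f).w b / I.w b)
  let L : ι → (Fin s → Fin n) → ℝ := fun f z => ∏ i, r f (z i)
  have hr : ∀ f b, I.w b / I.total * r f b = (J f).w b / W := by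
    intro f b
    simp only [r]
    -- Division by zero is harmless: `hJ` makes the alternative weight vanish too.
    by_cases h0 : I.w b = 0
    · rcases hJ f b with h | h <;> simp [h, h0]
    · field_simp
  have hp0 : ∀ z, 0 ≤ p z := fun z =>
    Finset.prod_nonneg fun i _ => div_nonneg (I.nonneg _) hI.le
  have hp1 : ∑ z, p z = 1 := by
    simp only [p]
    rw [sum_prod_fin_eq_pow s (fun b => I.w b / I.total), ← Finset.sum_div]
    change (I.total / I.total) ^ s = 1
    rw [div_self hI.ne', one_pow]
  have hpL : ∀ f z, p z * L f z = ∏ i, (J f).w (z i) / W := by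
    intro f z
    simp only [p, L]
    rw [← Finset.prod_mul_distrib]
    exact Finset.prod_congr rfl fun i _ => hr _ _
  have hL : ∀ f, ∑ z, p z * L f z = 1 := by
    intro f
    simp only [hpL]
    rw [sum_prod_fin_eq_pow s (fun b => (J f).w b / W), ← Finset.sum_div]
    have : ∑ b, (J f).w b = W := hW f
    rw [this, div_self hWpos.ne', one_pow]
  have hLL : ∀ f f', ∑ z, p z * (L f z * L f' z) =
      (I.total / W ^ 2 * ∑ b, (J f).w b * (J f').w b / I.w b) ^ s := by
    intro f f'
    have h1 : ∀ z, p z * (L f z * L f' z) =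
        ∏ i, I.total / W ^ 2 * ((J f).w (z i) * (J f').w (z i) / I.w (z i)) := by
      intro z
      rw [← mul_assoc, hpL]
      simp only [L]
      rw [← Finset.prod_mul_distrib]
      refine Finset.prod_congr rfl fun i _ => ?_
      simp only [r]
      field_simp
    simp only [h1]
    rw [sum_prod_fin_eq_pow s
      (fun b => I.total / W ^ 2 * ((J f).w b * (J f').w b / I.w b)), Finset.mul_sum]
  have hmain := sum_test_le_of_secondMoment p v L hp0 hp1 (fun z => measureReal_nonneg)
    (fun z => measureReal_le_one) hL (by simpa only [hLL] using h2)
  have hu : 2 / 3 - 1 / 20 ≤ ∑ z, p z * u z := by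
    refine (haltsIn_real_ge A μ I a hs hA hA').trans_eq ?_
    exact I.prod_real_local μ a (fun ω x x' hx h => h.congr hx (fun _ _ => rfl))
      (measurableSet_haltsIn A I s measurableSet_Icc)
  have hv : ∀ f, 2 / 3 - 1 / 20 ≤ ∑ z, p z * L f z * v z := by
    intro f
    refine (haltsIn_real_ge A μ (J f) a hs hA hA').trans_eq ?_
    rw [(J f).prod_real_local μ a (fun ω x x' hx h => h.congr hx (fun _ _ => rfl))
      (measurableSet_haltsIn A (J f) s measurableSet_Icc), hW f]
    refine Finset.sum_congr rfl fun z _ => ?_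
    rw [hpL]
    -- Sequences impossible under `J f` carry no mass. On the others all weights agree with those of
    -- `I`, so both runs have the same outcome.
    by_cases h0 : ∏ i, (J f).w (z i) / W = 0
    · rw [h0, zero_mul, zero_mul]
    congr 1
    have hw : ∀ i < s, (J f).w (extendSeq a z i) = I.w (extendSeq a z i) := by
      intro i hi
      rw [show extendSeq a z i = z ⟨i, hi⟩ from extendSeq_coe a z ⟨i, hi⟩]
      refine (hJ f _).resolve_left fun h => ?_
      exact h0 (Finset.prod_eq_zero (Finset.mem_univ ⟨i, hi⟩) (by rw [h, zero_div]))
    simp only [v]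
    congr 1
    ext ω
    exact ⟨fun h => h.congr (fun _ _ => rfl) hw,
      fun h => h.congr (fun _ _ => rfl) (fun i hi => (hw i hi).symm)⟩
  have huv : ∑ z, p z * u z + ∑ z, p z * v z ≤ 1 := by
    rw [← Finset.sum_add_distrib, ← hp1]
    refine Finset.sum_le_sum fun z _ => ?_
    have : u z + v z ≤ 1 := by
      simp only [u, v]
      rw [← measureReal_union _ (measurableSet_haltsIn A I s measurableSet_Icc _)]
      · exact measureReal_le_one
      · exact Set.disjoint_left.mpr fun ω h h' => h.not_of_disjoint hdisj h'
    nlinarith [hp0 z]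
  have hsum : (Fintype.card ι : ℝ) * (2 / 3 - 1 / 20) ≤ ∑ f, ∑ z, p z * L f z * v z := by
    have := Finset.sum_le_sum fun f (_ : f ∈ Finset.univ) => hv f
    rwa [Finset.sum_const, nsmul_eq_mul, Finset.card_univ] at this
  have hc : (0 : ℝ) < Fintype.card ι := by exact_mod_cast Fintype.card_pos
  have := le_of_mul_le_mul_left (hsum.trans hmain) hc
  linarith

end PropAlgorithm

/-! ### Random block patterns and their second moment -/

/-- The exponential moment of the number of agreements between two random functions. -/
theorem sum_sum_exp_agreements (N b : ℕ) (θ : ℝ) :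
    ∑ f : Fin N → Fin b, ∑ f' : Fin N → Fin b,
      Real.exp (θ * ∑ i, if f i = f' i then 1 else 0) =
      (b : ℝ) ^ N * ((b : ℝ) - 1 + Real.exp θ) ^ N := by
  have h : ∀ f : Fin N → Fin b, ∑ f' : Fin N → Fin b,
      Real.exp (θ * ∑ i, if f i = f' i then 1 else 0) = ((b : ℝ) - 1 + Real.exp θ) ^ N := by
    intro f
    have h1 : ∀ f' : Fin N → Fin b, Real.exp (θ * ∑ i, if f i = f' i then 1 else 0) =
        ∏ i, if f i = f' i then Real.exp θ else 1 := by
      intro f'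
      rw [Finset.mul_sum, Real.exp_sum]
      refine Finset.prod_congr rfl fun i _ => ?_
      split_ifs <;> simp
    simp only [h1]
    rw [← Fintype.piFinset_univ,
      Finset.sum_prod_piFinset Finset.univ (fun i j => if f i = j then Real.exp θ else 1)]
    have h2 : ∀ i, ∑ j, (if f i = j then Real.exp θ else 1) = (b : ℝ) - 1 + Real.exp θ := by
      intro i
      have h3 : ∀ j, (if f i = j then Real.exp θ else 1) =
          (1 : ℝ) + if f i = j then Real.exp θ - 1 else 0 := by
        intro j
        split_ifs <;> ring
      simp only [h3, Finset.sum_add_distrib, Finset.sum_ite_eq, Finset.mem_univ, if_true]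
      simp
      ring
    simp only [h2]
    simp
  simp only [h]
  simp

/-- Kept items in a block: block pattern `j` keeps the items `i` with `t j i = 1`; every pattern
keeps `g` items, and two patterns share `c₀` items, or `c₀ + 1` if they are equal. -/
structure BlockPattern (b : ℕ) (g c₀ : ℝ) where
  t : Fin b → Fin b → ℝ
  zero_or_one : ∀ j i, t j i = 0 ∨ t j i = 1
  sum_eq : ∀ j, ∑ i, t j i = g
  overlap : ∀ j j', ∑ i, t j i * t j' i = c₀ + if j = j' then 1 else 0

/-- Exactly one item is kept. -/
def BlockPattern.single (b : ℕ) : BlockPattern b 1 0 where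
  t j i := if i = j then 1 else 0
  zero_or_one j i := by split_ifs <;> simp
  sum_eq j := by simp
  overlap j j' := by simp [eq_comm]

/-- All items but one are kept. -/
def BlockPattern.compl (b : ℕ) : BlockPattern b (b - 1) (b - 2) where
  t j i := 1 - if i = j then 1 else 0
  zero_or_one j i := by split_ifs <;> simp
  sum_eq j := by simp
  overlap j j' := by
    have h : ∀ i, (1 - if i = j then (1 : ℝ) else 0) * (1 - if i = j' then 1 else 0) =
        1 - (if i = j then 1 else 0) - (if i = j' then 1 else 0) +
        (if i = j then if j = j' then 1 else 0 else 0) := by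
      intro i
      by_cases h1 : i = j
      · subst h1
        by_cases h2 : i = j' <;> simp [h2]
      · by_cases h2 : i = j' <;> simp [h1]
    simp only [h, Finset.sum_add_distrib, Finset.sum_sub_distrib, Finset.sum_ite_eq',
      Finset.mem_univ, if_true]
    simp
    ring

section Blocks

variable {N b r n : ℕ}

/-- A heavy item of weight `H`, blocks with weights `y`, and `r` items of weight zero. -/
def blockWeight (H : ℝ) (y : Fin N → Fin b → ℝ) : Unit ⊕ (Fin N × Fin b) ⊕ Fin r → ℝ
  | .inl _ => H
  | .inr (.inl q) => y q.1 q.2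
  | .inr (.inr _) => 0

theorem sum_blockWeight (H : ℝ) (y : Fin N → Fin b → ℝ) :
    ∑ a, blockWeight (r := r) H y a = H + ∑ i, ∑ j, y i j := by
  simp [blockWeight, Fintype.sum_sum_type, Fintype.sum_prod_type]

/-- The instance of size `n` with weights `blockWeight`. -/
def blockInstance (e : Fin n ≃ Unit ⊕ (Fin N × Fin b) ⊕ Fin r) (H : ℝ) (y : Fin N → Fin b → ℝ)
    (hH : 0 ≤ H) (hy : ∀ i j, 0 ≤ y i j) (hpos : 0 < H + ∑ i, ∑ j, y i j) : SumInstance n where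
  w a := blockWeight H y (e a)
  nonneg a := by
    rcases e a with _ | q | _
    · exact hH
    · exact hy _ _
    · exact le_rfl
  total_pos := by rwa [Equiv.sum_comp e (blockWeight H y), sum_blockWeight]

theorem blockInstance_total (e : Fin n ≃ Unit ⊕ (Fin N × Fin b) ⊕ Fin r) (H : ℝ)
    (y : Fin N → Fin b → ℝ) (hH : 0 ≤ H) (hy : ∀ i j, 0 ≤ y i j)
    (hpos : 0 < H + ∑ i, ∑ j, y i j) :
    (blockInstance e H y hH hy hpos).total = H + ∑ i, ∑ j, y i j := by
  rw [SumInstance.total, ← sum_blockWeight (r := r), ← Equiv.sum_comp e]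
  rfl

variable {Ω : Type*} [MeasurableSpace Ω]

/-- Bound each power by `(1 + x) ^ s ≤ exp (s x)`, then use the binomial exponential moment.
Centring the agreements at `N / b` cancels the linear term in `θ`, leaving `exp θ - 1 - θ ≤ θ ^ 2`.
-/
theorem secondMoment_le {g c₀ H W W' : ℝ} {s : ℕ} (hb : 0 < b)
    (hc₀ : c₀ * b + 1 = g ^ 2) (hc₀0 : 0 ≤ c₀) (hH : 0 ≤ H) (hW : W = H + N * g) (hWpos : 0 < W)
    (hW' : W' = H + N * b) (hθ : s * W' / W ^ 2 ≤ 1)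
    (hsmall : s * (H * N * (b - g) ^ 2 / (b * W ^ 2)) + N / b * (s * W' / W ^ 2) ^ 2 ≤ 1 / 30) :
    ∑ f : Fin N → Fin b, ∑ f' : Fin N → Fin b,
      (W' / W ^ 2 * (H + ∑ i, (c₀ + if f i = f' i then 1 else 0))) ^ s ≤
      (((b : ℝ) ^ N) ^ 2) * (1 + 1 / 25) := by
  have hb' : (0 : ℝ) < b := by exact_mod_cast hb
  have hW'0 : 0 ≤ W' := by rw [hW']; positivity
  set κ := H * N * (b - g) ^ 2 / (b * W ^ 2) with hκ
  set θ := s * W' / W ^ 2 with hθdef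
  have hθ0 : 0 ≤ θ := by positivity
  have hterm : ∀ f f' : Fin N → Fin b,
      (W' / W ^ 2 * (H + ∑ i, (c₀ + if f i = f' i then 1 else 0))) ^ s ≤
      Real.exp (s * κ - θ * (N / b)) * Real.exp (θ * ∑ i, if f i = f' i then 1 else 0) := by
    intro f f'
    set M : ℝ := ∑ i, if f i = f' i then 1 else 0
    have hM : 0 ≤ M := Finset.sum_nonneg fun i _ => by split_ifs <;> norm_num
    have hsum : ∑ i, (c₀ + if f i = f' i then 1 else 0) = N * c₀ + M := by
      simp [Finset.sum_add_distrib, M]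
    rw [hsum, ← Real.exp_add]
    -- At the mean `M = N / b` the overlap exceeds 1 by exactly `κ`; `c₀ * b + 1 = g ^ 2` turns the
    -- excess into a square.
    have heq : W' / W ^ 2 * (H + (N * c₀ + M)) =
        (κ + W' / W ^ 2 * (M - N / b)) + 1 := by
      have hc : c₀ = (g ^ 2 - 1) / b := by field_simp; linarith
      rw [hκ, hc]
      field_simp
      rw [hW, hW']
      ring
    have hexp : s * κ - θ * (N / b) + θ * M = s * (κ + W' / W ^ 2 * (M - N / b)) := by
      rw [hθdef]; ring
    rw [hexp, Real.exp_nat_mul]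
    have hnn : 0 ≤ W' / W ^ 2 * (H + (N * c₀ + M)) := by positivity
    refine pow_le_pow_left₀ hnn ?_ s
    rw [heq]
    exact Real.add_one_le_exp _
  refine (Finset.sum_le_sum fun f _ => Finset.sum_le_sum fun f' _ => hterm f f').trans ?_
  simp only [← Finset.mul_sum]
  rw [sum_sum_exp_agreements]
  have h1 : ((b : ℝ) - 1 + Real.exp θ) ^ N ≤
      (b : ℝ) ^ N * Real.exp (N * ((Real.exp θ - 1) / b)) := by
    rw [Real.exp_nat_mul, ← mul_pow]
    refine pow_le_pow_left₀ ?_ ?_ N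
    · have := Real.one_le_exp hθ0
      linarith
    · have h2 := mul_le_mul_of_nonneg_left (Real.add_one_le_exp ((Real.exp θ - 1) / b)) hb'.le
      refine le_trans (le_of_eq ?_) h2
      field_simp
      ring
  have h3 : Real.exp θ - 1 - θ ≤ θ ^ 2 :=
    (le_abs_self _).trans (Real.abs_exp_sub_one_sub_id_le (by rw [abs_of_nonneg hθ0]; exact hθ))
  have h4 : s * κ - θ * (N / b) + N * ((Real.exp θ - 1) / b) ≤ 1 / 30 := by
    have : N / b * (Real.exp θ - 1 - θ) ≤ N / b * θ ^ 2 :=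
      mul_le_mul_of_nonneg_left h3 (by positivity)
    have e : s * κ - θ * (N / b) + N * ((Real.exp θ - 1) / b) =
      s * κ + N / b * (Real.exp θ - 1 - θ) := by ring
    linarith
  have h5 : Real.exp (1 / 30) ≤ 1 + 1 / 25 := by
    have := Real.abs_exp_sub_one_sub_id_le (x := 1 / 30) (by rw [abs_of_nonneg] <;> norm_num)
    have := (le_abs_self _).trans this
    norm_num at this ⊢
    linarith
  calc Real.exp (s * κ - θ * (N / b)) * ((b : ℝ) ^ N * ((b : ℝ) - 1 + Real.exp θ) ^ N)
      ≤ Real.exp (s * κ - θ * (N / b)) *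
        ((b : ℝ) ^ N * ((b : ℝ) ^ N * Real.exp (N * ((Real.exp θ - 1) / b)))) := by gcongr
    _ = ((b : ℝ) ^ N) ^ 2 * Real.exp (s * κ - θ * (N / b) + N * ((Real.exp θ - 1) / b)) := by
        rw [Real.exp_add]; ring
    _ ≤ ((b : ℝ) ^ N) ^ 2 * (1 + 1 / 25) := by
        gcongr
        exact (Real.exp_le_exp.mpr h4).trans h5

/-- The lower bound obtained from blocks of items in which a random pattern is kept. -/
theorem BlockPattern.false_of_algorithm {g c₀ : ℝ} (T : BlockPattern b g c₀) {H W W' : ℝ} {s : ℕ}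
    (hb : 0 < b) (hn : 1 + N * b ≤ n) (hc₀ : c₀ * b + 1 = g ^ 2) (hc₀0 : 0 ≤ c₀) (hH : 0 ≤ H)
    (hW : W = H + N * g) (hWpos : 0 < W) (hgb : g ≤ b)
    (hW' : W' = H + N * b) (hθ : s * W' / W ^ 2 ≤ 1)
    (hsmall : s * (H * N * (b - g) ^ 2 / (b * W ^ 2)) + N / b * (s * W' / W ^ 2) ^ 2 ≤ 1 / 30)
    {m ε : ℝ} (hsep : (1 + ε) * W < (1 - ε) * W') (hs : 20 * m < s + 1)
    (A : PropAlgorithm Ω) (μ : Measure Ω) [IsProbabilityMeasure μ]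
    (hA : A.ExpectedSamplesLE μ n m) (hA' : A.Approximates μ n ε) : False := by
  obtain ⟨e⟩ : Nonempty (Fin n ≃ Unit ⊕ (Fin N × Fin b) ⊕ Fin (n - (1 + N * b))) := by
    refine ⟨Fintype.equivOfCardEq ?_⟩
    simp
    omega
  have : NeZero b := ⟨hb.ne'⟩
  have hsum1 : ∀ f : Fin N → Fin b, H + ∑ i, ∑ j, T.t (f i) j = W := by
    intro f
    simp [T.sum_eq, hW]
  have hsum2 : H + ∑ _i : Fin N, ∑ _j : Fin b, (1 : ℝ) = W' := by
    simp [hW']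
  have hWW' : W ≤ W' := by
    rw [hW, hW']
    gcongr
  have ht0 : ∀ j i, 0 ≤ T.t j i := fun j i => by
    rcases T.zero_or_one j i with h | h <;> simp [h]
  let I := blockInstance e H (fun _ _ => 1) hH (fun _ _ => zero_le_one)
    (by rw [hsum2]; exact hWpos.trans_le hWW')
  let J : (Fin N → Fin b) → SumInstance n := fun f =>
    blockInstance e H (fun i j => T.t (f i) j) hH (fun i j => ht0 _ _) (by rwa [hsum1])
  have hI : I.total = W' := by rw [blockInstance_total, hsum2]
  refine PropAlgorithm.false_of_secondMoment I J (W := W) ?_ ?_ (by rwa [hI]) ?_ hs A μ hA hA'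
  · intro f a
    simp only [I, J, blockInstance]
    rcases e a with _ | q | _
    · exact Or.inr rfl
    · exact T.zero_or_one _ _
    · exact Or.inl rfl
  · intro f
    rw [blockInstance_total, hsum1]
  · have hsq : ∀ f f', ∑ a, (J f).w a * (J f').w a / I.w a =
        H + ∑ i, (c₀ + if f i = f' i then 1 else 0) := by
      intro f f'
      have h1 : ∀ a, (J f).w a * (J f').w a / I.w a =
          blockWeight H (fun i j => T.t (f i) j * T.t (f' i) j) (e a) := by
        intro a
        simp only [I, J, blockInstance]
        -- The heavy item contributes `H * H / H`, which is `H` even for `H = 0`.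
        rcases e a with _ | q | _ <;> simp [blockWeight]
      simp only [h1]
      rw [Equiv.sum_comp e (blockWeight H (fun i j => T.t (f i) j * T.t (f' i) j)),
        sum_blockWeight]
      simp only [T.overlap]
    simp only [hsq, hI]
    have := secondMoment_le (N := N) hb hc₀ hc₀0 hH hW hWpos hW' hθ hsmall
    simpa using this

end Blocks

/-! ### Choice of the parameters in each range of `ε` -/

/-- Dividing `n - 1` rather than `n` leaves room for the heavy item, while the blocks still fill
half of the instance. -/
theorem half_le_div_mul {n b : ℕ} (hb : 0 < b) (h : 2 * b ≤ n) :
    (n : ℝ) / 2 ≤ ((n - 1) / b : ℕ) * (b : ℝ) ∧ 1 + (n - 1) / b * b ≤ n := by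
  have h1 := Nat.div_add_mod (n - 1) b
  have h2 := Nat.mod_lt (n - 1) hb
  have h3 : (n - 1) / b * b = b * ((n - 1) / b) := mul_comm _ _
  constructor
  · have h4 : n ≤ 2 * ((n - 1) / b * b) := by omega
    have h5 : (n : ℝ) ≤ 2 * (((n - 1) / b : ℕ) * (b : ℝ)) := by exact_mod_cast h4
    linarith
  · omega

namespace PropAlgorithm

variable {Ω : Type*} [MeasurableSpace Ω]

theorem WorstCaseSamplesLE.expectedSamplesLE {A : PropAlgorithm Ω} {μ : Measure Ω}
    [IsProbabilityMeasure μ] {n : ℕ} {m : ℝ} (h : A.WorstCaseSamplesLE μ n m) :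
    A.ExpectedSamplesLE μ n m := fun I => by
  simpa using lintegral_mono_ae (h I)

/-- Keeping one item of each block of constant size, for `ε` bounded away from `0`. -/
theorem false_of_single {n b s : ℕ} {m ε : ℝ} (hb : 2 ≤ b) (hn : 2 * b ≤ n)
    (hsep : 1 + ε < (1 - ε) * b) (hε : 1 / 4 ≤ ε)
    (hsn : s * ε ≤ 1 / (2000 * b ^ 2) * √n) (hs : 20 * m < s + 1)
    (A : PropAlgorithm Ω) (μ : Measure Ω) [IsProbabilityMeasure μ]
    (hA : A.ExpectedSamplesLE μ n m) (hA' : A.Approximates μ n ε) : False := by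
  obtain ⟨hN, hN'⟩ := half_le_div_mul (by omega) hn
  set N := (n - 1) / b
  have hb' : (2 : ℝ) ≤ b := by exact_mod_cast hb
  have hn1 : (4 : ℝ) ≤ n := by exact_mod_cast (show 4 ≤ n by omega)
  have hNpos : (0 : ℝ) < N := by
    by_contra! h
    have : (N : ℝ) * b ≤ 0 := mul_nonpos_of_nonpos_of_nonneg h (by linarith)
    linarith
  have hsq : √(n : ℝ) ^ 2 = n := Real.sq_sqrt (by linarith)
  have hR : 2 ≤ √(n : ℝ) := Real.le_sqrt_of_sq_le (by linarith)
  have hs0 : (0 : ℝ) ≤ s := by positivity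
  have hs4 : s * b ^ 2 ≤ √(n : ℝ) / 500 := by
    have h1 : (s : ℝ) * (1 / 4) ≤ s * ε := mul_le_mul_of_nonneg_left hε hs0
    have h2 : (s : ℝ) * (1 / 4) * b ^ 2 ≤ 1 / (2000 * b ^ 2) * √n * b ^ 2 :=
      mul_le_mul_of_nonneg_right (h1.trans hsn) (by positivity)
    have h3 : 1 / (2000 * (b : ℝ) ^ 2) * √n * b ^ 2 = √n / 2000 := by field_simp
    linarith
  have hθ : s * (N * b : ℝ) / (N : ℝ) ^ 2 = s * b / N := by field_simp
  refine (BlockPattern.single b).false_of_algorithm (n := n) (N := N) (H := 0) (W := N)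
    (W' := N * b) (s := s) (m := m) (ε := ε)
    (by omega) hN' (by ring) le_rfl le_rfl (by ring) hNpos (by linarith) (by ring) ?_ ?_ ?_ hs
    A μ hA hA'
  · rw [hθ, div_le_one hNpos]
    nlinarith
  · rw [hθ]
    have h5 : 0 * N * ((b : ℝ) - 1) ^ 2 / (b * N ^ 2) = 0 := by simp
    have h6 : N / b * (s * b / N) ^ 2 = (s : ℝ) ^ 2 * b / N := by field_simp
    rw [h5, h6, mul_zero, zero_add, div_le_iff₀ hNpos]
    have h7 : ((s : ℝ) * b ^ 2) ^ 2 ≤ n / 250000 := by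
      have := pow_le_pow_left₀ (by positivity) hs4 2
      rw [div_pow, hsq] at this
      linarith
    have h8 : ((s : ℝ) ^ 2 * b) * b ≤ ((s : ℝ) * b ^ 2) ^ 2 := by
      have : (1 : ℝ) ≤ b ^ 2 := by nlinarith
      have := mul_le_mul_of_nonneg_left this (show (0 : ℝ) ≤ s ^ 2 * b ^ 2 by positivity)
      linarith
    refine le_of_mul_le_mul_right ?_ (show (0 : ℝ) < b by linarith)
    linarith
  · have := mul_lt_mul_of_pos_right hsep hNpos
    linarith

/-- Keeping all items but one of each block. -/
theorem false_of_compl {n N b s : ℕ} {m ε H W' : ℝ} (hb : 2 ≤ b) (hN : 0 < N)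
    (hn : 1 + N * b ≤ n) (hε : 0 < ε) (hH : 0 ≤ H) (hW' : W' = H + N * b)
    (hsep : 2 * ε * W' ≤ N) (h4s : 4 * s ≤ W')
    (hsmall : 30 * (4 * s * H * N + 16 * N * s ^ 2) ≤ b * W' ^ 2) (hs : 20 * m < s + 1)
    (A : PropAlgorithm Ω) (μ : Measure Ω) [IsProbabilityMeasure μ]
    (hA : A.ExpectedSamplesLE μ n m) (hA' : A.Approximates μ n ε) : False := by
  have hb' : (2 : ℝ) ≤ b := by exact_mod_cast hb
  have hNpos : (0 : ℝ) < N := by exact_mod_cast hN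
  have h2N : 2 * (N : ℝ) ≤ W' := by nlinarith
  have hW'pos : 0 < W' := by linarith
  have hW2 : W' / 2 ≤ W' - N := by linarith
  have hWpos : 0 < W' - N := by linarith
  have hWsq : W' ^ 2 ≤ 4 * (W' - N) ^ 2 := by nlinarith
  have hθ : s * W' / (W' - N) ^ 2 ≤ 4 * s / W' := by
    rw [div_le_div_iff₀ (by positivity) hW'pos]
    have := mul_le_mul_of_nonneg_left hWsq (show (0 : ℝ) ≤ s by positivity)
    linarith
  refine (BlockPattern.compl b).false_of_algorithm (n := n) (N := N) (H := H) (W := W' - N)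
    (W' := W') (s := s) (m := m) (ε := ε)
    (by omega) hn (by ring) (by linarith) hH (by rw [hW']; ring) hWpos (by linarith) hW'
    (hθ.trans ((div_le_one hW'pos).mpr h4s)) ?_ ?_ hs A μ hA hA'
  · have h1 : s * (H * N * ((b : ℝ) - (b - 1)) ^ 2 / (b * (W' - N) ^ 2)) ≤
        4 * s * H * N / (b * W' ^ 2) := by
      rw [sub_sub_cancel, one_pow, mul_one, ← mul_div_assoc,
        div_le_div_iff₀ (by positivity) (by positivity)]
      have := mul_le_mul_of_nonneg_left hWsq (show (0 : ℝ) ≤ s * H * N * b by positivity)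
      linarith
    have h2 : N / b * (s * W' / (W' - N) ^ 2) ^ 2 ≤ 16 * N * s ^ 2 / (b * W' ^ 2) := by
      have : N / b * (s * W' / (W' - N) ^ 2) ^ 2 ≤ N / b * (4 * s / W') ^ 2 := by gcongr
      refine this.trans_eq ?_
      field_simp
      ring
    have h3 : 4 * s * H * N / (b * W' ^ 2) + 16 * N * s ^ 2 / (b * W' ^ 2) ≤ 1 / 30 := by
      rw [← add_div, div_le_div_iff₀ (by positivity) (by norm_num)]
      linarith
    linarith
  · nlinarith

/-- Without a heavy item, removing one item per block changes the total by the fraction `1 / b`, so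
`b ≈ 1 / (2 ε)`. This works while `s` is small compared with `n`, which is ensured when `ε √n ≥ 1`.
For smaller `ε`, blocks of size about `√n / 2` are diluted by a heavy item that makes the total `N /
(2 ε)`. -/
theorem false_of_lt_quarter {n s : ℕ} {m ε : ℝ} (hn : 64 ≤ n) (hε : 0 < ε) (hε' : ε < 1 / 4)
    (hsn : s * ε ≤ 1 / 2000 * √n) (hs : 20 * m < s + 1)
    (A : PropAlgorithm Ω) (μ : Measure Ω) [IsProbabilityMeasure μ]
    (hA : A.ExpectedSamplesLE μ n m) (hA' : A.Approximates μ n ε) : False := by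
  have hn' : (64 : ℝ) ≤ n := by exact_mod_cast hn
  have hsq : √(n : ℝ) ^ 2 = n := Real.sq_sqrt (by linarith)
  have hR : 8 ≤ √(n : ℝ) := Real.le_sqrt_of_sq_le (by linarith)
  set R := √(n : ℝ)
  have hs0 : (0 : ℝ) ≤ s := by positivity
  rcases le_or_gt 1 (ε * R) with hcase | hcase
  · set b := ⌊1 / (2 * ε)⌋₊
    have hbu : b * (2 * ε) ≤ 1 := by
      have := Nat.floor_le (show 0 ≤ 1 / (2 * ε) by positivity)
      rwa [le_div_iff₀ (by positivity)] at this
    have hbl : 1 < (b + 1) * (2 * ε) := by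
      have := Nat.lt_floor_add_one (1 / (2 * ε))
      rwa [div_lt_iff₀ (by positivity)] at this
    have hb : 2 ≤ b := by
      apply Nat.le_floor
      rw [le_div_iff₀ (by positivity)]
      push_cast
      linarith
    have hb' : (2 : ℝ) ≤ b := by exact_mod_cast hb
    have hbR : 2 * (b : ℝ) ≤ R := by
      have : 2 * (b : ℝ) * ε ≤ R * ε := by linarith
      exact le_of_mul_le_mul_right this hε
    have hbn : 2 * b ≤ n := by
      have : (2 * (b : ℝ)) ≤ n := by nlinarith
      exact_mod_cast this
    obtain ⟨hN, hN'⟩ := half_le_div_mul (by omega) hbn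
    set N := (n - 1) / b
    have hNpos : 0 < N := by
      rcases Nat.eq_zero_or_pos N with h | h
      · rw [h] at hN
        simp at hN
        linarith
      · exact h
    have hNpos' : (0 : ℝ) < N := by exact_mod_cast hNpos
    have hsR : (s : ℝ) ≤ n / 2000 := by
      have : (s : ℝ) * (ε * R) ≤ n / 2000 := by nlinarith
      nlinarith
    have hsb : (s : ℝ) ≤ R / 500 * b := by
      have h1 : 1 ≤ 4 * ε * b := by linarith
      have h2 := mul_le_mul_of_nonneg_left h1 hs0
      have h3 := mul_le_mul_of_nonneg_right hsn (show (0 : ℝ) ≤ 4 * b by positivity)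
      linarith
    refine false_of_compl hb hNpos hN' hε le_rfl (zero_add (N * b : ℝ)).symm ?_ ?_ ?_ hs A μ hA hA'
    · nlinarith
    · linarith
    · have h1 : (s : ℝ) ^ 2 ≤ n / 250000 * b ^ 2 := by
        have := pow_le_pow_left₀ hs0 hsb 2
        rw [mul_pow, div_pow, hsq] at this
        linarith
      have h2 : 480 * (s : ℝ) ^ 2 ≤ (N * b) * b ^ 2 := by
        have := mul_le_mul_of_nonneg_right hN (show (0 : ℝ) ≤ b ^ 2 by positivity)
        have : 0 ≤ (n : ℝ) * b ^ 2 := by positivity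
        linarith
      have := mul_le_mul_of_nonneg_left h2 hNpos'.le
      linarith
  · set b := ⌊R / 2⌋₊
    have hbu : (b : ℝ) ≤ R / 2 := Nat.floor_le (by linarith)
    have hbl : R / 2 < b + 1 := Nat.lt_floor_add_one _
    have hb' : (2 : ℝ) ≤ b := by linarith
    have hb : 2 ≤ b := by exact_mod_cast hb'
    have hbn : 2 * b ≤ n := by
      have : (2 * (b : ℝ)) ≤ n := by nlinarith
      exact_mod_cast this
    obtain ⟨hN, hN'⟩ := half_le_div_mul (by omega) hbn
    set N := (n - 1) / b
    have hRN : R ≤ N := by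
      have h1 : (N : ℝ) * b ≤ N * (R / 2) := mul_le_mul_of_nonneg_left hbu (by positivity)
      have h2 : R * (R / 2) ≤ N * (R / 2) := by nlinarith
      exact le_of_mul_le_mul_right h2 (by linarith)
    have hNpos' : (0 : ℝ) < N := by linarith
    have hNpos : 0 < N := by exact_mod_cast hNpos'
    have hH : 0 ≤ N / (2 * ε) - N * (b : ℝ) := by
      rw [sub_nonneg, le_div_iff₀ (by positivity)]
      have : (b : ℝ) * (2 * ε) ≤ 1 := by nlinarith
      nlinarith
    -- This total makes the removed weight `N` exactly the fraction `2 ε`; the heavy item takes up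
    -- the rest.
    refine false_of_compl (W' := N / (2 * ε)) hb hNpos hN' hε hH (by ring) ?_ ?_ ?_ hs A μ hA hA'
    · rw [mul_div_cancel₀ _ (by positivity)]
    · rw [le_div_iff₀ (by positivity)]
      linarith
    · have hx0 : 0 ≤ s * ε := by positivity
      have h1 : 30 * (4 * s * (N / (2 * ε) - N * b) * N + 16 * N * s ^ 2) ≤
          30 * (4 * s * (N / (2 * ε)) * N + 16 * N * (s : ℝ) ^ 2) := by
        gcongr
        have : 0 ≤ (N : ℝ) * b := by positivity
        linarith
      refine h1.trans ?_
      have h2 : 30 * (4 * s * (N / (2 * ε)) * N + 16 * N * (s : ℝ) ^ 2) =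
          N / (4 * ε ^ 2) * (240 * (s * ε) * N + 1920 * (s * ε) ^ 2) := by
        field_simp
        ring
      have h3 : b * (N / (2 * ε)) ^ 2 = N / (4 * ε ^ 2) * (b * N) := by
        field_simp
        norm_num
      rw [h2, h3]
      refine mul_le_mul_of_nonneg_left ?_ (by positivity)
      have h4 : (s * ε) * N ≤ 1 / 2000 * R * N := mul_le_mul_of_nonneg_right hsn hNpos'.le
      have h5 : (s * ε) ^ 2 ≤ (1 / 2000 * R) * (1 / 2000 * N) := by
        rw [pow_two]
        exact mul_le_mul hsn (hsn.trans (by linarith)) hx0 (by positivity)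
      have h6 : R / 4 * N ≤ b * N := mul_le_mul_of_nonneg_right (by linarith) hNpos'.le
      have h7 : 0 ≤ R * N := by positivity
      linarith

end PropAlgorithm

/-- Let `ε₀ < 1` and let `m (n, ε) = o(√n / ε)` as `n → ∞`, uniformly over `0 < ε ≤ ε₀`. Then for
all sufficiently large `n` and all `0 < ε ≤ ε₀`, no algorithm, even one designed for these values
of `n` and `ε`, draws at most `m (n, ε)` samples (in the worst case, or just in expectation) on
every instance of size `n` and returns a `(1 ± ε)`-approximation of the total weight with
probability at least `2/3` on every such instance. -/
theorem mainTheorem7 (ε₀ : ℝ) (hε₀ : ε₀ < 1) (m : ℕ → ℝ → ℝ)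
    (hm : (fun p : ℕ × ℝ => m p.1 p.2)
      =o[atTop ×ˢ 𝓟 (Set.Ioc 0 ε₀)] (fun p : ℕ × ℝ => √(p.1 : ℝ) / p.2)) :
    ∃ n₀ : ℕ, ∀ n : ℕ, n₀ ≤ n → ∀ ε : ℝ, 0 < ε → ε ≤ ε₀ →
      ∀ (Ω : Type*) [MeasurableSpace Ω] (μ : Measure Ω) [IsProbabilityMeasure μ]
        (A : PropAlgorithm Ω),
        ¬ (A.WorstCaseSamplesLE μ n (m n ε) ∧ A.Approximates μ n ε) ∧
        ¬ (A.ExpectedSamplesLE μ n (m n ε) ∧ A.Approximates μ n ε) := by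
  -- Keeping one of `b` items must separate the windows even at `ε₀`; adding 2 gives `2 ≤ b`.
  obtain ⟨b₀, hb₀⟩ := exists_nat_gt ((1 + ε₀) / (1 - ε₀))
  set b := b₀ + 2
  have hb : 2 ≤ b := Nat.le_add_left _ _
  have hb' : (2 : ℝ) ≤ b := by exact_mod_cast hb
  have hbsep : 1 + ε₀ < (1 - ε₀) * b := by
    rw [div_lt_iff₀ (by linarith)] at hb₀
    have : (b : ℝ) = b₀ + 2 := by simp [b]
    rw [this]
    linarith
  set δ : ℝ := 1 / (2000 * (b : ℝ) ^ 2)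
  have hδ : 0 < δ := by positivity
  have hδ' : δ ≤ 1 / 2000 := by
    refine one_div_le_one_div_of_le (by norm_num) ?_
    nlinarith
  -- The 20 absorbs the factor in `s = ⌊20 m⌋`, so that `s ε ≤ δ √n`.
  have hev := hm.bound (show 0 < δ / 20 by positivity)
  rw [eventually_prod_principal_iff] at hev
  obtain ⟨n₁, hn₁⟩ := eventually_atTop.mp hev
  refine ⟨max n₁ (max 64 (2 * b)), fun n hn ε hε hεε Ω _ μ _ A => ?_⟩
  have key : A.ExpectedSamplesLE μ n (m n ε) → A.Approximates μ n ε → False := by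
    intro hA hA'
    have hb1 := hn₁ n ((le_max_left _ _).trans hn) ε ⟨hε, hεε⟩
    have hs : 20 * m n ε < ⌊20 * m n ε⌋₊ + 1 := Nat.lt_floor_add_one _
    have hsn : (⌊20 * m n ε⌋₊ : ℝ) * ε ≤ δ * √n := by
      rw [Real.norm_eq_abs, Real.norm_of_nonneg (by positivity)] at hb1
      have h1 : (⌊20 * m n ε⌋₊ : ℝ) ≤ 20 * |m n ε| :=
        (Nat.cast_le.mpr (Nat.floor_mono (by linarith [le_abs_self (m n ε)]))).trans
          (Nat.floor_le (by positivity))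
      have h2 : (⌊20 * m n ε⌋₊ : ℝ) ≤ δ * √n / ε :=
        (h1.trans (mul_le_mul_of_nonneg_left hb1 (by norm_num))).trans_eq (by ring)
      rwa [le_div_iff₀ hε] at h2
    rcases lt_or_ge ε (1 / 4) with h4 | h4
    · exact PropAlgorithm.false_of_lt_quarter (by omega) hε h4
        (hsn.trans (mul_le_mul_of_nonneg_right hδ' (Real.sqrt_nonneg _))) hs A μ hA hA'
    · refine PropAlgorithm.false_of_single hb (by omega) ?_ h4 hsn hs A μ hA hA'
      nlinarith
  exact ⟨fun h => key h.1.expectedSamplesLE h.2, fun h => key h.1 h.2⟩
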